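/- Let $n \ge 0$ be an integer, let $[n] = \{1,\dots,n\}$, and let $\mathcal{A}, \mathcal{B}$ be families of subsets of $[n]$. Suppose that $(\mathcal{A},\mathcal{B})$ is a recovering pair over $[n]$, that is, for all $A, A' \in \mathcal{A}$ and all $B, B' \in \mathcal{B}$, $$A \setminus B = A' \setminus B' \implies A = A' \qquad\text{and}\qquad B \setminus A = B' \setminus A' \implies B = B'.$$ Then $$|\mathcal{A}|\,|\mathcal{B}| \le 2.2543^n.$$ -/

import Mathlib

/-- Two families `𝒜`, `ℬ` of subsets of a finite ground set `X` form a recovering pair over `X` if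
`A \ B` determines `A` and `B \ A` determines `B`, for `A ∈ 𝒜` and `B ∈ ℬ`. -/
def IsRecoveringPair {X : Type*} [DecidableEq X] (𝒜 ℬ : Finset (Finset X)) : Prop :=
  ∀ A ∈ 𝒜, ∀ A' ∈ 𝒜, ∀ B ∈ ℬ, ∀ B' ∈ ℬ,
    (A \ B = A' \ B' → A = A') ∧ (B \ A = B' \ A' → B = B')

/-!
Let `A` and `B` be independent and uniform in `𝒜` and `ℬ`. Since `A \ B` determines `A`, and then
`A ∩ B`, the entropy of `A \ B` is `log |𝒜| + 𝔼_A H(B ∩ A)`; it is at most the sum over the ground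
set of the binary entropies `h(p (1 - q))`, where `p` and `q` are the densities of an element in
`𝒜` and `ℬ`.

For the lower bound on `𝔼_A H(B ∩ A)`, let `U` be any set of elements. Since `B` can be recovered
from `B \ A`, the trace `B ∩ U` has entropy at least `log |ℬ|` minus the sum over `i ∉ U` of
`(1 - p) h(q)`. Feeding this into Shearer's inequality, with the elements added in order of
decreasing density in `𝒜` and the weights truncated at a threshold `τ`, gives
`𝔼_A H(B ∩ A) ≥ τ log |ℬ| - ∑ (τ - p)⁺ (1 - p) h(q)`.

Adding the resulting bound on `log |𝒜| + τ log |ℬ|` to its mirror image leaves an inequality in one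
pair `(p, q)`. For `τ = 1 / 2` it follows from the quartic Taylor bound on the binary entropy at
`1 / 2`.
-/

open Finset Real
open scoped BigOperators

section Determines

variable {Ω β γ : Type*} {s : Finset Ω}

/-- On `s`, the value of `f` determines the value of `g`. -/
def DeterminesOn (s : Finset Ω) (f : Ω → β) (g : Ω → γ) : Prop :=
  ∀ ⦃x⦄, x ∈ s → ∀ ⦃y⦄, y ∈ s → f x = f y → g x = g y

open Classical in
/-- The points of `s` at which `f` takes the same value as at `ω`. -/
noncomputable def fiberOn (s : Finset Ω) (f : Ω → β) (ω : Ω) : Finset Ω :=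
  {x ∈ s | f x = f ω}

lemma mem_fiberOn {f : Ω → β} {x ω : Ω} : x ∈ fiberOn s f ω ↔ x ∈ s ∧ f x = f ω := by
  simp [fiberOn]

lemma card_fiberOn_pos (f : Ω → β) {ω : Ω} (hω : ω ∈ s) : 0 < #(fiberOn s f ω) :=
  card_pos.2 ⟨ω, mem_fiberOn.2 ⟨hω, rfl⟩⟩

lemma fiberOn_congr {f : Ω → β} {x y : Ω} (h : f x = f y) : fiberOn s f x = fiberOn s f y := by
  rw [fiberOn, fiberOn, h]

lemma DeterminesOn.fiberOn_subset {f : Ω → β} {g : Ω → γ} (h : DeterminesOn s f g) {ω : Ω}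
    (hω : ω ∈ s) : fiberOn s f ω ⊆ fiberOn s g ω := fun x hx => by
  obtain ⟨hxs, hfx⟩ := mem_fiberOn.1 hx
  exact mem_fiberOn.2 ⟨hxs, h hxs hω hfx⟩

end Determines

section Density

variable {Ω Ω' : Type*}

/-- The probability of the event `P` under the uniform distribution on `s`. -/
noncomputable def density (s : Finset Ω) (P : Ω → Prop) [DecidablePred P] : ℝ :=
  #{ω ∈ s | P ω} / #s

lemma density_nonneg (s : Finset Ω) (P : Ω → Prop) [DecidablePred P] : 0 ≤ density s P := by
  unfold density
  positivity

lemma density_le_one (s : Finset Ω) (P : Ω → Prop) [DecidablePred P] : density s P ≤ 1 :=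
  div_le_one_of_le₀ (mod_cast card_filter_le _ _) (Nat.cast_nonneg _)

lemma density_not {s : Finset Ω} (hs : s.Nonempty) (P : Ω → Prop) [DecidablePred P] :
    density s (fun ω => ¬ P ω) = 1 - density s P := by
  have hcard : (#{ω ∈ s | P ω} : ℝ) + #{ω ∈ s | ¬ P ω} = #s :=
    mod_cast card_filter_add_card_filter_not P
  have hs0 : (#s : ℝ) ≠ 0 := by simpa using hs.ne_empty
  rw [density, density, eq_sub_iff_add_eq', ← add_div, hcard, div_self hs0]

lemma density_product (s : Finset Ω) (t : Finset Ω') (P : Ω → Prop) (Q : Ω' → Prop)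
    [DecidablePred P] [DecidablePred Q] :
    density (s ×ˢ t) (fun x => P x.1 ∧ Q x.2) = density s P * density t Q := by
  simp only [density, filter_product, card_product, Nat.cast_mul, mul_div_mul_comm]

lemma expect_ite_eq_density_mul (s : Finset Ω) (P : Ω → Prop) [DecidablePred P] (c : ℝ) :
    𝔼 ω ∈ s, (if P ω then c else 0) = density s P * c := by
  rw [expect_eq_sum_div_card, ← sum_filter, sum_const, nsmul_eq_mul, density, div_mul_eq_mul_div]

end Density

section Entropy

variable {Ω Ω' β γ δ ε : Type*} {s : Finset Ω}

/-- The Shannon entropy, in nats, of `f ω` for `ω` uniformly distributed on `s`: the expectation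
of `-log` of the probability of the observed value. -/
noncomputable def unifEntropy (s : Finset Ω) (f : Ω → β) : ℝ :=
  𝔼 ω ∈ s, log (#s / #(fiberOn s f ω))

lemma unifEntropy_le_of_determinesOn {f : Ω → β} {g : Ω → γ} (h : DeterminesOn s f g) :
    unifEntropy s g ≤ unifEntropy s f := by
  refine expect_le_expect fun ω hω => ?_
  have hs : (0 : ℝ) < #s := mod_cast card_pos.2 ⟨ω, hω⟩
  have hf : (0 : ℝ) < #(fiberOn s f ω) := mod_cast card_fiberOn_pos f hω
  have hg : (0 : ℝ) < #(fiberOn s g ω) := mod_cast card_fiberOn_pos g hω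
  gcongr
  exact h.fiberOn_subset hω

lemma unifEntropy_of_injOn {f : Ω → β} (h : Set.InjOn f s) : unifEntropy s f = log #s := by
  have hfiber : ∀ ω ∈ s, fiberOn s f ω = {ω} := fun ω hω => by
    ext x
    rw [mem_fiberOn, mem_singleton]
    exact ⟨fun hx => h hx.1 hω hx.2, by rintro rfl; exact ⟨hω, rfl⟩⟩
  rw [unifEntropy, expect_congr rfl fun ω hω => by rw [hfiber ω hω]]
  rcases s.eq_empty_or_nonempty with rfl | hs
  · simp
  · simp [expect_const hs]

lemma unifEntropy_const (s : Finset Ω) (c : β) : unifEntropy s (fun _ => c) = 0 := by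
  refine expect_eq_zero fun ω hω => ?_
  have hs : (#s : ℝ) ≠ 0 := by simpa using ne_empty_of_mem hω
  simp [fiberOn, hs]

lemma sum_inv_card_fiberOn_le_one {f : Ω → β} {t : Finset Ω} (hts : t ⊆ s)
    (hf : ∀ x ∈ t, ∀ y ∈ t, f x = f y) : ∑ ω ∈ t, (#(fiberOn s f ω) : ℝ)⁻¹ ≤ 1 := by
  have hle : ∀ ω ∈ t, (#(fiberOn s f ω) : ℝ)⁻¹ ≤ (#t : ℝ)⁻¹ := fun ω hω => by
    have ht : (0 : ℝ) < #t := mod_cast card_pos.2 ⟨ω, hω⟩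
    gcongr
    exact fun x hx => mem_fiberOn.2 ⟨hts hx, hf x hx ω hω⟩
  calc ∑ ω ∈ t, (#(fiberOn s f ω) : ℝ)⁻¹ ≤ #t • (#t : ℝ)⁻¹ := sum_le_card_nsmul _ _ _ hle
    _ = #t * (#t : ℝ)⁻¹ := nsmul_eq_mul _ _
    _ ≤ 1 := mul_inv_le_one

section Submodular

variable {f : Ω → β} {g : Ω → γ} {j : Ω → δ} {k : Ω → ε}

lemma sum_fiberOn_inter_inv_mul_inv_le [DecidableEq Ω] (hfk : DeterminesOn s f k)
    (hj : DeterminesOn s (fun ω => (f ω, g ω)) j) {x : Ω} (hx : x ∈ s) (y : Ω) :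
    ∑ ω ∈ fiberOn s f x ∩ fiberOn s g y, (#(fiberOn s j ω) : ℝ)⁻¹ * (#(fiberOn s k ω) : ℝ)⁻¹ ≤
      (#(fiberOn s k x) : ℝ)⁻¹ := by
  have hk : ∀ ω ∈ fiberOn s f x ∩ fiberOn s g y, fiberOn s k ω = fiberOn s k x := fun ω hω => by
    obtain ⟨hωs, hfω⟩ := mem_fiberOn.1 (mem_inter.1 hω).1
    exact fiberOn_congr (hfk hωs hx hfω)
  rw [sum_congr rfl fun ω hω => by rw [hk ω hω], ← sum_mul]
  refine mul_le_of_le_one_left (by positivity) (sum_inv_card_fiberOn_le_one ?_ ?_)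
  · exact fun ω hω => (mem_fiberOn.1 (mem_inter.1 hω).1).1
  · intro ω hω ω' hω'
    simp only [mem_inter, mem_fiberOn] at hω hω'
    exact hj hω.1.1 hω'.1.1 (Prod.ext (hω.1.2.trans hω'.1.2.symm) (hω.2.2.trans hω'.2.2.symm))

-- Double counting of the triples `(ω, x, y)` with `f x = f ω` and `g y = g ω`.
lemma sum_card_fiberOn_ratio_le (hfk : DeterminesOn s f k) (hgk : DeterminesOn s g k)
    (hj : DeterminesOn s (fun ω => (f ω, g ω)) j) :
    ∑ ω ∈ s, (#(fiberOn s f ω) * #(fiberOn s g ω) : ℝ) / (#(fiberOn s j ω) * #(fiberOn s k ω)) ≤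
      #s := by
  classical
  let c : Ω → ℝ := fun ω => (#(fiberOn s j ω) : ℝ)⁻¹ * (#(fiberOn s k ω) : ℝ)⁻¹
  have hswap_x : ∀ ω x, ω ∈ s ∧ x ∈ fiberOn s f ω ↔ ω ∈ fiberOn s f x ∧ x ∈ s := fun ω x => by
    grind [mem_fiberOn]
  have hswap_y : ∀ x ∈ s, ∀ ω y, ω ∈ fiberOn s f x ∧ y ∈ fiberOn s g ω ↔
      ω ∈ fiberOn s f x ∩ fiberOn s g y ∧ y ∈ fiberOn s k x := fun x hx ω y => by
    simp only [mem_inter, mem_fiberOn]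
    constructor
    · rintro ⟨⟨hω, hfω⟩, hy, hgy⟩
      exact ⟨⟨⟨hω, hfω⟩, hω, hgy.symm⟩, hy, (hgk hy hω hgy).trans (hfk hω hx hfω)⟩
    · rintro ⟨⟨⟨hω, hfω⟩, -, hgω⟩, hy, -⟩
      exact ⟨⟨hω, hfω⟩, hy, hgω.symm⟩
  calc ∑ ω ∈ s, (#(fiberOn s f ω) * #(fiberOn s g ω) : ℝ) /
        (#(fiberOn s j ω) * #(fiberOn s k ω))
      = ∑ ω ∈ s, ∑ _x ∈ fiberOn s f ω, ∑ _y ∈ fiberOn s g ω, c ω := by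
        simp only [c, sum_const, nsmul_eq_mul, div_eq_mul_inv, mul_inv, mul_assoc]
    _ = ∑ x ∈ s, ∑ ω ∈ fiberOn s f x, ∑ _y ∈ fiberOn s g ω, c ω := sum_comm' hswap_x
    _ = ∑ x ∈ s, ∑ y ∈ fiberOn s k x, ∑ ω ∈ fiberOn s f x ∩ fiberOn s g y, c ω :=
        sum_congr rfl fun x hx => sum_comm' (hswap_y x hx)
    _ ≤ ∑ x ∈ s, ∑ _y ∈ fiberOn s k x, (#(fiberOn s k x) : ℝ)⁻¹ :=
        sum_le_sum fun x hx => sum_le_sum fun y _ => sum_fiberOn_inter_inv_mul_inv_le hfk hj hx y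
    _ = ∑ x ∈ s, 1 := sum_congr rfl fun x hx => by
        rw [sum_const, nsmul_eq_mul, mul_inv_cancel₀ (mod_cast (card_fiberOn_pos k hx).ne')]
    _ = #s := by simp

lemma unifEntropy_add_unifEntropy_le (hfk : DeterminesOn s f k) (hgk : DeterminesOn s g k)
    (hj : DeterminesOn s (fun ω => (f ω, g ω)) j) :
    unifEntropy s j + unifEntropy s k ≤ unifEntropy s f + unifEntropy s g := by
  have hlog : ∀ ω ∈ s, log (#s / #(fiberOn s j ω)) + log (#s / #(fiberOn s k ω)) -
      (log (#s / #(fiberOn s f ω)) + log (#s / #(fiberOn s g ω))) ≤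
      (#(fiberOn s f ω) * #(fiberOn s g ω) : ℝ) / (#(fiberOn s j ω) * #(fiberOn s k ω)) - 1 := by
    intro ω hω
    have hs : (#s : ℝ) ≠ 0 := by simpa using ne_empty_of_mem hω
    have hf : (#(fiberOn s f ω) : ℝ) ≠ 0 := mod_cast (card_fiberOn_pos f hω).ne'
    have hg : (#(fiberOn s g ω) : ℝ) ≠ 0 := mod_cast (card_fiberOn_pos g hω).ne'
    have hj : (#(fiberOn s j ω) : ℝ) ≠ 0 := mod_cast (card_fiberOn_pos j hω).ne'
    have hk : (#(fiberOn s k ω) : ℝ) ≠ 0 := mod_cast (card_fiberOn_pos k hω).ne'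
    refine le_trans (le_of_eq ?_) (log_le_sub_one_of_pos (by positivity))
    rw [log_div hs hj, log_div hs hk, log_div hs hf, log_div hs hg,
      log_div (mul_ne_zero hf hg) (mul_ne_zero hj hk), log_mul hf hg, log_mul hj hk]
    ring
  rw [← sub_nonpos]
  simp only [unifEntropy, ← expect_add_distrib, ← expect_sub_distrib]
  refine (expect_le_expect hlog).trans ?_
  rw [expect_eq_sum_div_card, sum_sub_distrib, sum_const, nsmul_one]
  exact div_nonpos_of_nonpos_of_nonneg (sub_nonpos.2 (sum_card_fiberOn_ratio_le hfk hgk hj))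
    (Nat.cast_nonneg _)

lemma unifEntropy_le_add (hj : DeterminesOn s (fun ω => (f ω, g ω)) j) :
    unifEntropy s j ≤ unifEntropy s f + unifEntropy s g := by
  simpa only [unifEntropy_const, add_zero] using
    unifEntropy_add_unifEntropy_le (k := fun _ => ()) (fun _ _ _ _ _ => rfl)
      (fun _ _ _ _ _ => rfl) hj

end Submodular

lemma unifEntropy_prop (s : Finset Ω) (P : Ω → Prop) [DecidablePred P] :
    unifEntropy s P = binEntropy (density s P) := by
  rcases s.eq_empty_or_nonempty with rfl | hs
  · simp [unifEntropy, density]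
  have hterm : ∀ ω ∈ s, log (#s / #(fiberOn s P ω)) =
      (if P ω then log (density s P)⁻¹ else 0) +
        (if ¬ P ω then log (density s fun ω => ¬ P ω)⁻¹ else 0) := fun ω _ => by
    by_cases hω : P ω <;> simp [fiberOn, density, hω]
  rw [unifEntropy, expect_congr rfl hterm, expect_add_distrib, expect_ite_eq_density_mul,
    expect_ite_eq_density_mul, density_not hs, binEntropy]

lemma card_fiberOn_product {t : Finset Ω'} (g : Ω → Ω' → β) {a : Ω} (ha : a ∈ s) (b : Ω') :
    #(fiberOn (s ×ˢ t) (fun x => (x.1, g x.1 x.2)) (a, b)) = #(fiberOn t (g a) b) := by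
  have hprod : fiberOn (s ×ˢ t) (fun x => (x.1, g x.1 x.2)) (a, b) =
      {a} ×ˢ fiberOn t (g a) b := by
    ext ⟨a', b'⟩
    simp only [mem_fiberOn, mem_product, mem_singleton, Prod.mk.injEq]
    grind
  rw [hprod, card_product, card_singleton, one_mul]

lemma unifEntropy_product {t : Finset Ω'} (ht : t.Nonempty) (s : Finset Ω) (g : Ω → Ω' → β) :
    unifEntropy (s ×ˢ t) (fun x => (x.1, g x.1 x.2)) = log #s + 𝔼 a ∈ s, unifEntropy t (g a) := by
  rcases s.eq_empty_or_nonempty with rfl | hs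
  · simp [unifEntropy]
  rw [← expect_const hs (log (#s : ℝ)), ← expect_add_distrib, unifEntropy, expect_product]
  refine expect_congr rfl fun a ha => ?_
  rw [← expect_const ht (log (#s : ℝ)), unifEntropy, ← expect_add_distrib]
  refine expect_congr rfl fun b hb => ?_
  have hs0 : (#s : ℝ) ≠ 0 := by simpa using hs.ne_empty
  have ht0 : (#t : ℝ) ≠ 0 := by simpa using ht.ne_empty
  have hfiber : (#(fiberOn t (g a) b) : ℝ) ≠ 0 := mod_cast (card_fiberOn_pos (g a) hb).ne'
  rw [card_fiberOn_product g ha, card_product, Nat.cast_mul, mul_div_assoc,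
    log_mul hs0 (div_ne_zero ht0 hfiber)]

end Entropy

section BinaryEntropy

lemma two_mul_add_cube_le_log_one_add_sub_log_one_sub {x : ℝ} (hx₀ : 0 ≤ x) (hx₁ : x < 1) :
    2 * x + 2 / 3 * x ^ 3 ≤ log (1 + x) - log (1 - x) := by
  have hseries := hasSum_log_sub_log_of_abs_lt_one (abs_lt.2 ⟨by linarith, hx₁⟩)
  have htrunc := sum_le_hasSum (Finset.range 2) (fun i _ => by positivity) hseries
  norm_num [Finset.sum_range_succ] at htrunc
  linarith

lemma four_mul_add_cube_le_log_sub_log_one_sub {p : ℝ} (hp₀ : 1 / 2 ≤ p) (hp₁ : p < 1) :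
    4 * (p - 1 / 2) + 16 / 3 * (p - 1 / 2) ^ 3 ≤ log p - log (1 - p) := by
  have h := two_mul_add_cube_le_log_one_add_sub_log_one_sub (x := 2 * p - 1) (by linarith)
    (by linarith)
  rw [show 1 + (2 * p - 1) = 2 * p by ring, show 1 - (2 * p - 1) = 2 * (1 - p) by ring,
    log_mul two_ne_zero (by linarith), log_mul two_ne_zero (by linarith)] at h
  linarith

lemma binEntropy_le_quartic_of_half_le {p : ℝ} (hp₀ : 1 / 2 ≤ p) (hp₁ : p ≤ 1) :
    binEntropy p ≤ log 2 - 2 * (p - 1 / 2) ^ 2 - 4 / 3 * (p - 1 / 2) ^ 4 := by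
  let F : ℝ → ℝ := fun p => binEntropy p + 2 * (p - 1 / 2) ^ 2 + 4 / 3 * (p - 1 / 2) ^ 4
  have hderiv : ∀ x ∈ interior (Set.Icc (1 / 2 : ℝ) 1), HasDerivAt F
      (log (1 - x) - log x + (4 * (x - 1 / 2) + 16 / 3 * (x - 1 / 2) ^ 3)) x := fun x hx => by
    rw [interior_Icc] at hx
    have hsub := (hasDerivAt_id x).sub_const (1 / 2)
    refine (((hasDerivAt_binEntropy (by linarith [hx.1]) hx.2.ne).add
      ((hsub.pow 2).const_mul 2)).add ((hsub.pow 4).const_mul (4 / 3))).congr_deriv ?_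
    norm_num
    ring
  have hanti : AntitoneOn F (Set.Icc (1 / 2) 1) := by
    refine antitoneOn_of_hasDerivWithinAt_nonpos (convex_Icc _ _)
      (by fun_prop) (fun x hx => (hderiv x hx).hasDerivWithinAt) fun x hx => ?_
    rw [interior_Icc] at hx
    linarith [four_mul_add_cube_le_log_sub_log_one_sub hx.1.le hx.2]
  have hF : F p ≤ F (1 / 2) := hanti ⟨le_rfl, by norm_num⟩ ⟨hp₀, hp₁⟩ hp₀
  have hhalf : F (1 / 2) = log 2 := by simp [F]
  simp only [hhalf, F] at hF
  linarith

lemma binEntropy_le_quartic {p : ℝ} (hp₀ : 0 ≤ p) (hp₁ : p ≤ 1) :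
    binEntropy p ≤ log 2 - 2 * (1 / 2 - p) ^ 2 - 4 / 3 * (1 / 2 - p) ^ 4 := by
  rcases le_total (1 / 2) p with hp | hp
  · linarith [binEntropy_le_quartic_of_half_le hp hp₁]
  · have h := binEntropy_le_quartic_of_half_le (p := 1 - p) (by linarith) (by linarith)
    rw [binEntropy_one_sub] at h
    linarith

lemma binEntropy_le_quadratic {p : ℝ} (hp₀ : 0 ≤ p) (hp₁ : p ≤ 1) :
    binEntropy p ≤ log 2 - 2 * (1 / 2 - p) ^ 2 :=
  (binEntropy_le_quartic hp₀ hp₁).trans (by linarith [show 0 ≤ (1 / 2 - p) ^ 4 by positivity])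

end BinaryEntropy

section SingleLetter

/-- The contribution of one element of the ground set to the bound on `log |𝒜| + τ log |ℬ|`, where
`p` and `q` are the densities of that element in `𝒜` and `ℬ`. -/
noncomputable def singleLetter (τ p q : ℝ) : ℝ :=
  binEntropy (p * (1 - q)) + max (τ - p) 0 * ((1 - p) * binEntropy q)

variable {α β : ℝ}

-- The two probabilities are `1 / 2 - (u - d)` and `1 / 2 - (u + d)` for `u = 1 / 4 + α * β` and
-- `d = (α - β) / 2`, so the odd powers of `d` cancel.
lemma binEntropy_add_binEntropy_le (hα : |α| ≤ 1 / 2) (hβ : |β| ≤ 1 / 2) :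
    binEntropy ((1 / 2 - β) * (1 / 2 + α)) + binEntropy ((1 / 2 - α) * (1 / 2 + β)) ≤
      2 * log 2 - 4 * (1 / 4 + α * β) ^ 2 - (α - β) ^ 2 - 8 / 3 * (1 / 4 + α * β) ^ 4 -
        4 * ((1 / 4 + α * β) ^ 2 * (α - β) ^ 2) - (α - β) ^ 4 / 6 := by
  obtain ⟨hα₀, hα₁⟩ := abs_le.1 hα
  obtain ⟨hβ₀, hβ₁⟩ := abs_le.1 hβ
  have hleft := binEntropy_le_quartic (p := (1 / 2 - β) * (1 / 2 + α))
    (mul_nonneg (by linarith) (by linarith))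
    (mul_le_one₀ (by linarith) (by linarith) (by linarith))
  have hright := binEntropy_le_quartic (p := (1 / 2 - α) * (1 / 2 + β))
    (mul_nonneg (by linarith) (by linarith))
    (mul_le_one₀ (by linarith) (by linarith) (by linarith))
  linarith

lemma binEntropy_add_binEntropy_le_of_mul_nonneg (hα : |α| ≤ 1 / 2) (hβ : |β| ≤ 1 / 2)
    (hαβ : 0 ≤ α * β) :
    binEntropy ((1 / 2 - β) * (1 / 2 + α)) + binEntropy ((1 / 2 - α) * (1 / 2 + β)) ≤
      2 * log 2 - 25 / 96 - 5 / 4 * (α + β) ^ 2 + 17 / 6 * (α * β) - 5 * (α * β) ^ 2 := by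
  have hfourth : 1 / 256 + α * β / 16 + 3 / 8 * (α * β) ^ 2 ≤ (1 / 4 + α * β) ^ 4 := by
    linarith [pow_nonneg hαβ 3, pow_nonneg hαβ 4]
  have hcross : 1 / 16 * (α - β) ^ 2 ≤ (1 / 4 + α * β) ^ 2 * (α - β) ^ 2 :=
    mul_le_mul_of_nonneg_right (by linarith [sq_nonneg (α * β)]) (sq_nonneg _)
  have hdiff : 0 ≤ (α - β) ^ 4 := by positivity
  linarith [binEntropy_add_binEntropy_le hα hβ]

-- Cauchy–Schwarz for `α / 2 = 2 * α * (1 / 4 + α * β) - 2 * α ^ 2 * β`, where `2 * α ^ 2 ≤ 1 / 2`.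
lemma sq_div_five_le_sq_add (hα : |α| ≤ 1 / 2) (β : ℝ) :
    α ^ 2 / 5 ≤ β ^ 2 + 4 * ((1 / 4 + α * β) ^ 2 * α ^ 2) := by
  have hsq : 2 * α ^ 2 ≤ 1 / 2 := by linarith [sq_le_sq' (abs_le.1 hα).1 (abs_le.1 hα).2]
  have hcoeff : 1 + (2 * α ^ 2) ^ 2 ≤ 5 / 4 := by
    linarith [pow_le_pow_left₀ (by positivity) hsq 2]
  set S := β ^ 2 + 4 * ((1 / 4 + α * β) ^ 2 * α ^ 2) with hS
  have hcauchy : α ^ 2 / 4 ≤ (1 + (2 * α ^ 2) ^ 2) * S := by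
    rw [hS]
    linarith [sq_nonneg (2 * α ^ 2 * (2 * α * (1 / 4 + α * β)) + β)]
  have hle : (1 + (2 * α ^ 2) ^ 2) * S ≤ 5 / 4 * S :=
    mul_le_mul_of_nonneg_right hcoeff (by positivity)
  linarith

lemma binEntropy_add_binEntropy_le_of_mul_nonpos (hα : |α| ≤ 1 / 2) (hβ : |β| ≤ 1 / 2)
    (hαβ : α * β ≤ 0) :
    binEntropy ((1 / 2 - β) * (1 / 2 + α)) + binEntropy ((1 / 2 - α) * (1 / 2 + β)) ≤
      2 * log 2 - 1 / 4 - 6 / 5 * α ^ 2 := by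
  have hcross : (1 / 4 + α * β) ^ 2 * α ^ 2 ≤ (1 / 4 + α * β) ^ 2 * (α - β) ^ 2 :=
    mul_le_mul_of_nonneg_left (by linarith [sq_nonneg β]) (sq_nonneg _)
  have hfourth : 0 ≤ (1 / 4 + α * β) ^ 4 := by positivity
  have hdiff : 0 ≤ (α - β) ^ 4 := by positivity
  linarith [binEntropy_add_binEntropy_le hα hβ, sq_div_five_le_sq_add hα β, sq_nonneg (α * β)]

lemma max_mul_binEntropy_le (hα : |α| ≤ 1 / 2) (hβ : 0 ≤ β) :
    max β 0 * ((1 / 2 + β) * binEntropy (1 / 2 - α)) ≤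
      β * (1 / 2 + β) * (log 2 - 2 * α ^ 2) := by
  obtain ⟨hα₀, hα₁⟩ := abs_le.1 hα
  have hquad := binEntropy_le_quadratic (p := 1 / 2 - α) (by linarith) (by linarith)
  rw [sub_sub_cancel] at hquad
  rw [max_eq_left hβ, ← mul_assoc]
  exact mul_le_mul_of_nonneg_left hquad (by positivity)

lemma singleLetter_half_sub (α β : ℝ) : singleLetter (1 / 2) (1 / 2 - β) (1 / 2 - α) =
    binEntropy ((1 / 2 - β) * (1 / 2 + α)) +
      max β 0 * ((1 / 2 + β) * binEntropy (1 / 2 - α)) := by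
  rw [singleLetter, sub_sub_cancel, show 1 - (1 / 2 - α) = 1 / 2 + α by ring,
    show 1 - (1 / 2 - β) = 1 / 2 + β by ring]

lemma singleLetter_half_add_le_of_nonneg (hα : |α| ≤ 1 / 2) (hβ : |β| ≤ 1 / 2)
    (hα₀ : 0 ≤ α) (hβ₀ : 0 ≤ β) :
    singleLetter (1 / 2) (1 / 2 - β) (1 / 2 - α) + singleLetter (1 / 2) (1 / 2 - α) (1 / 2 - β) ≤
      51 / 29 * log 2 := by
  rw [singleLetter_half_sub, singleLetter_half_sub]
  have hdiff := binEntropy_add_binEntropy_le_of_mul_nonneg hα hβ (mul_nonneg hα₀ hβ₀)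
  have hlog : log 2 * (7 / 29 + (α + β) / 2 + α ^ 2 + β ^ 2) ≤
      0.6931471808 * (7 / 29 + (α + β) / 2 + α ^ 2 + β ^ 2) :=
    mul_le_mul_of_nonneg_right log_two_lt_d9.le (by positivity)
  -- A concave quadratic in `α * β` and `α + β`, negative at its maximum.
  have hquadratic : 0.6931471808 * (7 / 29 + (α + β) / 2 + (α + β) ^ 2 - 2 * (α * β)) - 25 / 96 -
      5 / 4 * (α + β) ^ 2 + 17 / 6 * (α * β) - 9 * (α * β) ^ 2 - α * β * (α + β) ≤ 0 := by
    linarith [sq_nonneg (α * β + (α + β) / 18 - (17 / 6 - 2 * 0.6931471808) / 18),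
      sq_nonneg (α + β - 0.2515), (abs_le.1 hα).2, (abs_le.1 hβ).2]
  linarith [max_mul_binEntropy_le hα hβ₀, max_mul_binEntropy_le hβ hα₀]

lemma singleLetter_half_add_le_of_nonpos_of_nonneg (hα : |α| ≤ 1 / 2) (hβ : |β| ≤ 1 / 2)
    (hα₀ : 0 ≤ α) (hβ₀ : β ≤ 0) :
    singleLetter (1 / 2) (1 / 2 - β) (1 / 2 - α) + singleLetter (1 / 2) (1 / 2 - α) (1 / 2 - β) ≤
      51 / 29 * log 2 := by
  rw [singleLetter_half_sub, singleLetter_half_sub, max_eq_right hβ₀, zero_mul, add_zero]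
  have hdiff := binEntropy_add_binEntropy_le_of_mul_nonpos hα hβ
    (mul_nonpos_of_nonneg_of_nonpos hα₀ hβ₀)
  have hlog : log 2 * (7 / 29 + α / 2 + α ^ 2) ≤ 0.6931471808 * (7 / 29 + α / 2 + α ^ 2) :=
    mul_le_mul_of_nonneg_right log_two_lt_d9.le (by positivity)
  have hdrop : 0 ≤ α * (1 / 2 + α) * β ^ 2 := by positivity
  linarith [max_mul_binEntropy_le hβ hα₀, sq_nonneg (α - 0.34), (abs_le.1 hα).2]

lemma singleLetter_half_add_le_of_nonpos (hα : |α| ≤ 1 / 2) (hβ : |β| ≤ 1 / 2)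
    (hα₀ : α ≤ 0) (hβ₀ : β ≤ 0) :
    singleLetter (1 / 2) (1 / 2 - β) (1 / 2 - α) + singleLetter (1 / 2) (1 / 2 - α) (1 / 2 - β) ≤
      51 / 29 * log 2 := by
  rw [singleLetter_half_sub, singleLetter_half_sub, max_eq_right hα₀, max_eq_right hβ₀]
  have hαβ : 0 ≤ α * β := mul_nonneg_of_nonpos_of_nonpos hα₀ hβ₀
  linarith [binEntropy_add_binEntropy_le_of_mul_nonneg hα hβ hαβ, log_two_lt_d9,
    sq_nonneg (α - β), sq_nonneg (α * β)]

lemma singleLetter_half_add_singleLetter_half_le {p q : ℝ} (hp₀ : 0 ≤ p) (hp₁ : p ≤ 1)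
    (hq₀ : 0 ≤ q) (hq₁ : q ≤ 1) :
    singleLetter (1 / 2) p q + singleLetter (1 / 2) q p ≤ 51 / 29 * log 2 := by
  obtain ⟨α, rfl⟩ : ∃ α, q = 1 / 2 - α := ⟨1 / 2 - q, by ring⟩
  obtain ⟨β, rfl⟩ : ∃ β, p = 1 / 2 - β := ⟨1 / 2 - p, by ring⟩
  have hα : |α| ≤ 1 / 2 := abs_le.2 ⟨by linarith, by linarith⟩
  have hβ : |β| ≤ 1 / 2 := abs_le.2 ⟨by linarith, by linarith⟩
  rcases le_total 0 α with hα₀ | hα₀ <;> rcases le_total 0 β with hβ₀ | hβ₀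
  · exact singleLetter_half_add_le_of_nonneg hα hβ hα₀ hβ₀
  · exact singleLetter_half_add_le_of_nonpos_of_nonneg hα hβ hα₀ hβ₀
  · rw [add_comm]
    exact singleLetter_half_add_le_of_nonpos_of_nonneg hβ hα hβ₀ hα₀
  · exact singleLetter_half_add_le_of_nonpos hα hβ hα₀ hβ₀

-- `34 / 29` is a rational number slightly below the base-2 logarithm of `2.2543`.
lemma mul_log_two_le_log : 34 / 29 * log 2 ≤ log 2.2543 := by
  have h : log (2 ^ 34) ≤ log (2.2543 ^ 29) := log_le_log (by positivity) (by norm_num)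
  rw [log_pow, log_pow] at h
  push_cast at h
  linarith

end SingleLetter

section WeightedShearer

variable {ι : Type*} [DecidableEq ι] {f : Finset ι → ℝ}

lemma density_mul_sub_le_expect_sub (hsub : ∀ U V, f (U ∪ V) + f (U ∩ V) ≤ f U + f V)
    (𝒜 : Finset (Finset ι)) (U : Finset ι) (a : ι) :
    density 𝒜 (a ∈ ·) * (f (insert a U) - f U) ≤
      𝔼 A ∈ 𝒜, f (A ∩ insert a U) - 𝔼 A ∈ 𝒜, f (A ∩ U) := by
  rw [← expect_ite_eq_density_mul, ← expect_sub_distrib]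
  refine expect_le_expect fun A _ => ?_
  split_ifs with ha
  · have h := hsub (A ∩ insert a U) U
    rw [show A ∩ insert a U ∪ U = insert a U by grind,
      show A ∩ insert a U ∩ U = A ∩ U by grind] at h
    linarith
  · rw [inter_insert_of_notMem ha, sub_self]

variable {𝒜 : Finset (Finset ι)} {e τ : ℝ} {g : ι → ℝ}

-- The elements of `U` are inserted in order of decreasing density. The last summand on the left is
-- the slack that lets the weight `m` drop to the density of the next element.
lemma add_sum_min_mul_add_slack_le_expect (hmono : Monotone f) (hempty : f ∅ = 0)
    (hsub : ∀ U V, f (U ∪ V) + f (U ∩ V) ≤ f U + f V) (hg : ∀ U, e + ∑ i ∈ U, g i ≤ f U)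
    (U : Finset ι) {m : ℝ} (hmτ : m ≤ τ) (hmU : ∀ i ∈ U, m ≤ density 𝒜 (i ∈ ·)) :
    τ * e + ∑ i ∈ U, min τ (density 𝒜 (i ∈ ·)) * g i + m * (f U - (e + ∑ i ∈ U, g i)) ≤
      𝔼 A ∈ 𝒜, f (A ∩ U) := by
  induction U using Finset.induction_on_min_value (fun i => density 𝒜 (i ∈ ·))
    generalizing m with
  | empty =>
    have he : (τ - m) * e ≤ 0 :=
      mul_nonpos_of_nonneg_of_nonpos (sub_nonneg.2 hmτ) (by simpa [hempty] using hg ∅)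
    simp only [inter_empty, hempty, expect_const_zero, sum_empty]
    linarith
  | insert a U ha hmin ih =>
    have hstep := density_mul_sub_le_expect_sub hsub 𝒜 U a
    have hm' : m ≤ min τ (density 𝒜 (a ∈ ·)) := le_min hmτ (hmU a (mem_insert_self a U))
    have hslack := mul_le_mul_of_nonneg_right hm' (sub_nonneg.2 (hg (insert a U)))
    have hgain := mul_le_mul_of_nonneg_right (min_le_right τ (density 𝒜 (a ∈ ·)))
      (sub_nonneg.2 (hmono (subset_insert a U)))
    have hU := ih (min_le_left τ _) fun i hi => (min_le_right τ _).trans (hmin i hi)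
    rw [sum_insert ha] at hslack ⊢
    rw [sum_insert ha]
    linarith

lemma add_sum_min_mul_le_expect (hmono : Monotone f) (hempty : f ∅ = 0)
    (hsub : ∀ U V, f (U ∪ V) + f (U ∩ V) ≤ f U + f V) (hg : ∀ U, e + ∑ i ∈ U, g i ≤ f U)
    (hτ : 0 ≤ τ) (U : Finset ι) :
    τ * e + ∑ i ∈ U, min τ (density 𝒜 (i ∈ ·)) * g i ≤ 𝔼 A ∈ 𝒜, f (A ∩ U) := by
  simpa using add_sum_min_mul_add_slack_le_expect hmono hempty hsub hg U hτ
    fun i _ => density_nonneg 𝒜 (i ∈ ·)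

end WeightedShearer

section Traces

variable {Ω ι : Type*} [DecidableEq ι]

lemma unifEntropy_inter_union_le (s : Finset Ω) (F : Ω → Finset ι) (U V : Finset ι) :
    unifEntropy s (fun ω => F ω ∩ (U ∪ V)) ≤
      unifEntropy s (fun ω => F ω ∩ U) + ∑ i ∈ V, binEntropy (density s (i ∈ F ·)) := by
  induction V using Finset.induction_on with
  | empty => simp
  | insert a V ha ih =>
    have hdet : DeterminesOn s (fun ω => (F ω ∩ (U ∪ V), a ∈ F ω))
        (fun ω => F ω ∩ (U ∪ insert a V)) := fun ω _ ω' _ h => by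
      simp only [Prod.mk.injEq, Finset.ext_iff, mem_inter, mem_union, mem_insert] at h ⊢
      grind
    rw [sum_insert ha, ← unifEntropy_prop]
    linarith [unifEntropy_le_add hdet]

lemma unifEntropy_le_sum_binEntropy [Fintype ι] (s : Finset Ω) (F : Ω → Finset ι) :
    unifEntropy s F ≤ ∑ i, binEntropy (density s (i ∈ F ·)) := by
  simpa [unifEntropy_const] using unifEntropy_inter_union_le s F ∅ univ

/-- The entropy of `B ∩ U` for a uniformly random member `B` of `ℬ`. -/
noncomputable def traceEntropy (ℬ : Finset (Finset ι)) (U : Finset ι) : ℝ :=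
  unifEntropy ℬ (· ∩ U)

lemma traceEntropy_empty (ℬ : Finset (Finset ι)) : traceEntropy ℬ ∅ = 0 := by
  simp only [traceEntropy, inter_empty, unifEntropy_const]

lemma determinesOn_inter (ℬ : Finset (Finset ι)) {U V : Finset ι} (h : U ⊆ V) :
    DeterminesOn ℬ (· ∩ V) (· ∩ U) := fun B _ B' _ hB => by
  beta_reduce at hB ⊢
  rw [← inter_eq_right.2 h, ← inter_assoc, ← inter_assoc, hB]

lemma traceEntropy_mono (ℬ : Finset (Finset ι)) : Monotone (traceEntropy ℬ) := fun _ _ h =>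
  unifEntropy_le_of_determinesOn (determinesOn_inter ℬ h)

lemma traceEntropy_union_add_traceEntropy_inter_le (ℬ : Finset (Finset ι)) (U V : Finset ι) :
    traceEntropy ℬ (U ∪ V) + traceEntropy ℬ (U ∩ V) ≤ traceEntropy ℬ U + traceEntropy ℬ V := by
  refine unifEntropy_add_unifEntropy_le (determinesOn_inter ℬ inter_subset_left)
    (determinesOn_inter ℬ inter_subset_right) fun B _ B' _ h => ?_
  obtain ⟨hU, hV⟩ := Prod.mk.inj h
  rw [inter_union_distrib_left, inter_union_distrib_left, hU, hV]

end Traces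

section RecoveringPairs

variable {ι : Type*} [DecidableEq ι] {𝒜 ℬ : Finset (Finset ι)}

lemma IsRecoveringPair.symm (h : IsRecoveringPair 𝒜 ℬ) : IsRecoveringPair ℬ 𝒜 :=
  fun B hB B' hB' A hA A' hA' => (h A hA A' hA' B hB B' hB').symm

lemma density_mem_sdiff_product (𝒜 : Finset (Finset ι)) (hℬ : ℬ.Nonempty) (i : ι) :
    density (𝒜 ×ˢ ℬ) (fun x => i ∈ x.1 \ x.2) =
      density 𝒜 (i ∈ ·) * (1 - density ℬ (i ∈ ·)) := by
  simp only [← density_not hℬ, ← density_product, mem_sdiff]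

lemma binEntropy_density_mem_sdiff (ℬ : Finset (Finset ι)) (A : Finset ι) (i : ι) :
    binEntropy (density ℬ (i ∈ · \ A)) = if i ∉ A then binEntropy (density ℬ (i ∈ ·)) else 0 := by
  split_ifs with hi <;> simp [density, hi]

variable [Fintype ι]

lemma log_card_le_traceEntropy_add_sum {A : Finset ι} (hA : Set.InjOn (· \ A) ℬ)
    (U : Finset ι) :
    log #ℬ ≤ traceEntropy ℬ U +
      ∑ i ∈ Uᶜ, if i ∉ A then binEntropy (density ℬ (i ∈ ·)) else 0 := by
  have hdet : DeterminesOn ℬ (· ∩ U) (fun B => (B \ A) ∩ U) := fun B _ B' _ hB => by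
    beta_reduce at hB ⊢
    rw [sdiff_inter_right_comm, sdiff_inter_right_comm, hB]
  calc log #ℬ = unifEntropy ℬ (· \ A) := (unifEntropy_of_injOn hA).symm
    _ = unifEntropy ℬ (fun B => (B \ A) ∩ (U ∪ Uᶜ)) := by simp only [union_compl, inter_univ]
    _ ≤ unifEntropy ℬ (fun B => (B \ A) ∩ U) + ∑ i ∈ Uᶜ, binEntropy (density ℬ (i ∈ · \ A)) :=
        unifEntropy_inter_union_le ℬ (· \ A) U Uᶜ
    _ ≤ _ := by
        simp only [binEntropy_density_mem_sdiff]
        exact add_le_add_left (unifEntropy_le_of_determinesOn hdet) _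

lemma log_card_le_traceEntropy_add_sum_one_sub_density (h𝒜 : 𝒜.Nonempty)
    (hinj : ∀ A ∈ 𝒜, Set.InjOn (· \ A) (ℬ : Set (Finset ι))) (U : Finset ι) :
    log #ℬ ≤ traceEntropy ℬ U +
      ∑ i ∈ Uᶜ, (1 - density 𝒜 (i ∈ ·)) * binEntropy (density ℬ (i ∈ ·)) := by
  have havg := le_expect h𝒜 fun A hA => log_card_le_traceEntropy_add_sum (hinj A hA) U
  simpa only [expect_add_distrib, expect_const h𝒜, expect_sum_comm, expect_ite_eq_density_mul,
    density_not h𝒜] using havg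

lemma mul_log_card_sub_le_expect_traceEntropy (h𝒜 : 𝒜.Nonempty)
    (hinj : ∀ A ∈ 𝒜, Set.InjOn (· \ A) (ℬ : Set (Finset ι))) {τ : ℝ} (hτ : 0 ≤ τ) :
    τ * log #ℬ - ∑ i, max (τ - density 𝒜 (i ∈ ·)) 0 *
        ((1 - density 𝒜 (i ∈ ·)) * binEntropy (density ℬ (i ∈ ·))) ≤
      𝔼 A ∈ 𝒜, traceEntropy ℬ A := by
  set g : ι → ℝ := fun i => (1 - density 𝒜 (i ∈ ·)) * binEntropy (density ℬ (i ∈ ·))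
  have hg : ∀ U, (log #ℬ - ∑ i, g i) + ∑ i ∈ U, g i ≤ traceEntropy ℬ U := fun U => by
    linarith [log_card_le_traceEntropy_add_sum_one_sub_density h𝒜 hinj U, sum_add_sum_compl U g]
  have hmax : ∀ i, max (τ - density 𝒜 (i ∈ ·)) 0 * g i =
      τ * g i - min τ (density 𝒜 (i ∈ ·)) * g i := fun i => by
    rw [max_comm, ← sub_self τ, max_sub_sub_left, sub_mul]
  have hshearer := add_sum_min_mul_le_expect (𝒜 := 𝒜) (traceEntropy_mono ℬ)
    (traceEntropy_empty ℬ) (traceEntropy_union_add_traceEntropy_inter_le ℬ) hg hτ univ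
  simp only [inter_univ] at hshearer
  rw [sum_congr rfl fun i _ => hmax i, sum_sub_distrib, ← mul_sum]
  linarith

lemma log_card_add_expect_traceEntropy_le (hℬ : ℬ.Nonempty)
    (hdet : DeterminesOn (𝒜 ×ˢ ℬ) (fun x => x.1 \ x.2) Prod.fst) :
    log #𝒜 + 𝔼 A ∈ 𝒜, traceEntropy ℬ A ≤
      ∑ i, binEntropy (density 𝒜 (i ∈ ·) * (1 - density ℬ (i ∈ ·))) := by
  have hdet' : DeterminesOn (𝒜 ×ˢ ℬ) (fun x => x.1 \ x.2) (fun x => (x.1, x.2 ∩ x.1)) :=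
    fun x hx y hy h => by
      have hfst : x.1 = y.1 := hdet hx hy h
      refine Prod.ext hfst ?_
      beta_reduce at h ⊢
      rw [inter_comm x.2, inter_comm y.2, ← sdiff_sdiff_self_left, ← sdiff_sdiff_self_left, h, hfst]
  calc log #𝒜 + 𝔼 A ∈ 𝒜, traceEntropy ℬ A
      = unifEntropy (𝒜 ×ˢ ℬ) (fun x => (x.1, x.2 ∩ x.1)) :=
        (unifEntropy_product hℬ 𝒜 fun A B => B ∩ A).symm
    _ ≤ unifEntropy (𝒜 ×ˢ ℬ) (fun x => x.1 \ x.2) := unifEntropy_le_of_determinesOn hdet'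
    _ ≤ ∑ i, binEntropy (density (𝒜 ×ˢ ℬ) fun x => i ∈ x.1 \ x.2) :=
        unifEntropy_le_sum_binEntropy _ _
    _ = _ := by simp only [density_mem_sdiff_product 𝒜 hℬ]

lemma IsRecoveringPair.log_card_add_mul_log_card_le (h : IsRecoveringPair 𝒜 ℬ)
    (h𝒜 : 𝒜.Nonempty) (hℬ : ℬ.Nonempty) {τ : ℝ} (hτ : 0 ≤ τ) :
    log #𝒜 + τ * log #ℬ ≤ ∑ i, singleLetter τ (density 𝒜 (i ∈ ·)) (density ℬ (i ∈ ·)) := by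
  have hdet : DeterminesOn (𝒜 ×ˢ ℬ) (fun x => x.1 \ x.2) Prod.fst := fun x hx y hy =>
    (h _ (mem_product.1 hx).1 _ (mem_product.1 hy).1 _ (mem_product.1 hx).2 _
      (mem_product.1 hy).2).1
  have hinj : ∀ A ∈ 𝒜, Set.InjOn (· \ A) (ℬ : Set (Finset ι)) := fun A hA B hB B' hB' =>
    (h A hA A hA B hB B' hB').2
  simp only [singleLetter, sum_add_distrib]
  linarith [log_card_add_expect_traceEntropy_le hℬ hdet,
    mul_log_card_sub_le_expect_traceEntropy h𝒜 hinj hτ]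

lemma IsRecoveringPair.log_card_add_log_card_le (h : IsRecoveringPair 𝒜 ℬ)
    (h𝒜 : 𝒜.Nonempty) (hℬ : ℬ.Nonempty) {τ c : ℝ} (hτ : 0 ≤ τ)
    (hc : ∀ p ∈ Set.Icc (0 : ℝ) 1, ∀ q ∈ Set.Icc (0 : ℝ) 1,
      singleLetter τ p q + singleLetter τ q p ≤ (1 + τ) * c) :
    log #𝒜 + log #ℬ ≤ Fintype.card ι * c := by
  have hsum : ∑ i, (singleLetter τ (density 𝒜 (i ∈ ·)) (density ℬ (i ∈ ·)) +
      singleLetter τ (density ℬ (i ∈ ·)) (density 𝒜 (i ∈ ·))) ≤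
      Fintype.card ι • ((1 + τ) * c) :=
    sum_le_card_nsmul _ _ _ fun i _ =>
      hc _ ⟨density_nonneg _ _, density_le_one _ _⟩ _ ⟨density_nonneg _ _, density_le_one _ _⟩
  rw [sum_add_distrib, nsmul_eq_mul] at hsum
  refine le_of_mul_le_mul_left ?_ (show 0 < 1 + τ by linarith)
  linarith [h.log_card_add_mul_log_card_le h𝒜 hℬ hτ, h.symm.log_card_add_mul_log_card_le hℬ h𝒜 hτ]

end RecoveringPairs

theorem theorem1p2_general {X : Type*} [DecidableEq X] [Fintype X] {𝒜 ℬ : Finset (Finset X)}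
    (h : IsRecoveringPair 𝒜 ℬ) :
    (𝒜.card : ℝ) * (ℬ.card : ℝ) ≤ (2.2543 : ℝ) ^ Fintype.card X := by
  rcases 𝒜.eq_empty_or_nonempty with rfl | h𝒜
  · simp only [card_empty, Nat.cast_zero, zero_mul]
    positivity
  rcases ℬ.eq_empty_or_nonempty with rfl | hℬ
  · simp only [card_empty, Nat.cast_zero, mul_zero]
    positivity
  have h𝒜₀ : (0 : ℝ) < #𝒜 := mod_cast h𝒜.card_pos
  have hℬ₀ : (0 : ℝ) < #ℬ := mod_cast hℬ.card_pos
  rw [← log_le_log_iff (by positivity) (by positivity), log_mul h𝒜₀.ne' hℬ₀.ne', log_pow]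
  refine h.log_card_add_log_card_le h𝒜 hℬ one_half_pos.le fun p hp q hq => ?_
  linarith [singleLetter_half_add_singleLetter_half_le hp.1 hp.2 hq.1 hq.2, mul_log_two_le_log]

theorem theorem1p2 (n : ℕ) (𝒜 ℬ : Finset (Finset (Fin n)))
    (h : IsRecoveringPair 𝒜 ℬ) :
    (𝒜.card : ℝ) * (ℬ.card : ℝ) ≤ (2.2543 : ℝ) ^ n := by
  simpa only [Fintype.card_fin] using theorem1p2_general h
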